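/- Let $T=\mathbb R$ or $T=[0,1]$, let $S\ge 1$ be an integer, and let $\{\phi_k\}\cup\{\psi_{lk}: l\ge J_0\}$ be an $S$-regular orthonormal wavelet basis of $L^2(T)$. For $T=\mathbb R$ this means $J_0=0$, $\phi_k=\phi(\cdot-k)$, $\psi_{lk}=2^{l/2}\psi(2^l\cdot-k)$, $k\in\mathbb Z$, with $\phi,\psi$ compactly supported and $S$ times continuously differentiable. For $T=[0,1]$ it means a boundary-corrected basis of Cohen--Daubechies--Vial type: finitely many $\phi_k$ and, at each level $l\ge J_0$, $2^l$ wavelets $\psi_{lk}$, which are dilates of a fixed finite set of left and right boundary wavelets and interior wavelets $2^{l/2}\psi(2^l\cdot-k)$ supported inside $(0,1)$; all these functions are $S$ times continuously differentiable with compact support, and all $\psi_{lk}$ are orthogonal in $L^2([0,1])$ to the polynomials of degree less than $S$. Put $\alpha_k(f)=\int_T f\phi_k$, $\beta_{lk}(f)=\int_T f\psi_{lk}$, $$K_j(f)=\sum_k\alpha_k(f)\phi_k+\sum_{J_0\le l<j}\sum_k\beta_{lk}(f)\psi_{lk},\qquad \|f\|_{u,\infty}=\max\Bigl(\sup_k|\alpha_k(f)|,\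 \sup_{l,k}2^{l(u+1/2)}|\beta_{lk}(f)|\Bigr).$$ Fix $B\ge 1$, $0<s<S$ and $t>s$. Let $\|\cdot\|_\infty$ be the sup-norm on $T$, let $\Sigma(u)$ be the set of bounded continuous probability densities $f$ on $T$ with $\|f\|_{u,\infty}\le B$, and let $r_n(s)=(\log n/n)^{s/(2s+1)}$. For $\rho\ge0$, $\varepsilon>0$ and $\ell\in\mathbb N$ put $$\tilde\Sigma(s,\rho)=\Bigl\{f\in\Sigma(s):\inf_{g\in\Sigma(t)}\|g-f\|_\infty\ge\rho\Bigr\},$$ $$\bar\Sigma(\varepsilon,s,\ell)=\bigl\{f\in\Sigma(s):\varepsilon2^{-ls}\le\|K_l(f)-f\|_\infty\le B2^{-ls}\ \text{for all } l\ge\ell\bigr\}.$$ (a) For every $\varepsilon>0$ there is a constant $c>0$, depending only on $\varepsilon,B,s,t$ and the basis, such that for every $\ell\in\mathbb N$ and every $f\in\bar\Sigma(\varepsilon,s,\ell)$, $$\inf_{g\in\Sigma(t)}\|f-g\|_\infty\ge c\,2^{-\ell s}.$$ Moreover, if $\ell_n\in\mathbb N$ satisfies $2^{-\ell_ns}/r_n(s)\to\infty$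 as $n\to\infty$, then for all $\varepsilon>0$ and $L_0>0$ there is $n_0$ such that $\bar\Sigma(\varepsilon,s,\ell_n)\subset\tilde\Sigma(s,L_0r_n(s))$ for all $n\ge n_0$. (b) For every $L_0'>0$ there is $n_0$, depending only on $s,t,B,L_0'$ and the basis, such that for every $\varepsilon>0$ and every sequence $\ell_n\in\mathbb N$ with $2^{-\ell_ns}/r_n(s)\to\infty$, the set $\tilde\Sigma(s,L_0'r_n(s))\setminus\bar\Sigma(\varepsilon,s,\ell_n)$ is nonempty for all $n\ge n_0$. (c) The condition $2^{-\ell_ns}/r_n(s)\to\infty$ holds in particular whenever, for some $R>s$, $2^{\ell_n}$ is of the exact order $(n/\log n)^{1/(2R+1)}$ as $n\to\infty$. -/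

import Mathlib

open Set Filter MeasureTheory Asymptotics
open scoped ENNReal

/-- The data of a wavelet family on a domain `T ⊆ ℝ`: scaling functions `φ k` for `k ∈ scalIdx`,
and wavelets `ψ l k` for levels `l ≥ J₀` and locations `k ∈ waveIdx l`.  Only the values on `T`
of the functions involved are ever used. -/
structure WaveletSystem where
  T : Set ℝ
  J₀ : ℕ
  scalIdx : Set ℤ
  waveIdx : ℕ → Set ℤ
  φ : ℤ → ℝ → ℝ
  ψ : ℕ → ℤ → ℝ → ℝ

namespace WaveletSystem

/-- Labels of the family: `Sum.inl k` for `φ k`, `Sum.inr (l, k)` for `ψ l k`. -/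
abbrev Idx (W : WaveletSystem) : Type :=
  {k : ℤ // k ∈ W.scalIdx} ⊕ {p : ℕ × ℤ // W.J₀ ≤ p.1 ∧ p.2 ∈ W.waveIdx p.1}

/-- The member of the family with a given label. -/
def member (W : WaveletSystem) : W.Idx → ℝ → ℝ
  | Sum.inl k => W.φ k.1
  | Sum.inr p => W.ψ p.1.1 p.1.2

/-- The family is (a family of representatives of) an orthonormal basis of `L²(T)`. -/
def IsONB (W : WaveletSystem) : Prop :=
  ∃ b : HilbertBasis W.Idx ℝ (Lp ℝ 2 (volume.restrict W.T)),
    ∀ i, (b i : ℝ → ℝ) =ᵐ[volume.restrict W.T] W.member i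

/-- The family on `T = ℝ` built from a scaling function and a mother wavelet:
`φ_k = φ(· - k)` and `ψ_{lk} = 2^{l/2} ψ(2^l · - k)`, for `l ≥ 0` and `k ∈ ℤ`. -/
noncomputable def line (φ ψ : ℝ → ℝ) : WaveletSystem where
  T := univ
  J₀ := 0
  scalIdx := univ
  waveIdx := fun _ => univ
  φ := fun k x => φ (x - k)
  ψ := fun l k x => (2 : ℝ) ^ ((l : ℝ) / 2) * ψ ((2 : ℝ) ^ l * x - k)

/-- The family on `T = [0,1]` with boundary corrections: `M` scaling functions at the coarsest
level `J₀`, and `2^l` wavelets at each level `l ≥ J₀`, namely `N` dilates of left boundary wavelets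
`ψL j`, the interior wavelets `2^{l/2} ψ(2^l · - k)` for `N ≤ k < 2^l - N`, and `N` dilates of
right boundary wavelets `ψR j` (which are functions of the distance to the endpoint `1`). -/
noncomputable def interval (J₀ N M : ℕ) (φ : ℤ → ℝ → ℝ) (ψ : ℝ → ℝ) (ψL ψR : ℤ → ℝ → ℝ) :
    WaveletSystem where
  T := Icc 0 1
  J₀ := J₀
  scalIdx := Ico 0 (M : ℤ)
  waveIdx := fun l => Ico 0 (2 ^ l : ℤ)
  φ := φ
  ψ := fun l k x => (2 : ℝ) ^ ((l : ℝ) / 2) *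
    (if k < N then ψL k ((2 : ℝ) ^ l * x)
     else if k < 2 ^ l - N then ψ ((2 : ℝ) ^ l * x - k)
     else ψR (2 ^ l - 1 - k) ((2 : ℝ) ^ l * (1 - x)))

/-- `S`-regular wavelet bases of `L²(ℝ)`: compactly supported, `S` times continuously
differentiable scaling function and mother wavelet. -/
def IsLineBasis (S : ℕ) (W : WaveletSystem) : Prop :=
  ∃ φ ψ : ℝ → ℝ,
    ContDiff ℝ S φ ∧ HasCompactSupport φ ∧ ContDiff ℝ S ψ ∧ HasCompactSupport ψ ∧
    W = line φ ψ ∧ W.IsONB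

/-- `S`-regular boundary-corrected wavelet bases of `L²([0,1])` (of Cohen--Daubechies--Vial type):
the interior wavelet lives on `[1 - N, N]`, so that all interior `ψ_{lk}` are supported inside
`(0,1)`; the level `J₀` is so large that left and right boundary indices do not overlap; all
functions are `S` times continuously differentiable with compact support; and the boundary correction
keeps the polynomials of degree less than `S` in the span of the scaling functions, i.e. all
wavelets, those at the boundary included, have `S` vanishing moments on `[0,1]`. -/
def IsIntervalBasis (S : ℕ) (W : WaveletSystem) : Prop :=
  ∃ (J₀ N M : ℕ) (φ : ℤ → ℝ → ℝ) (ψ : ℝ → ℝ) (ψL ψR : ℤ → ℝ → ℝ),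
    2 * N ≤ 2 ^ J₀ ∧
    (∀ k ∈ Ico 0 (M : ℤ), ContDiffOn ℝ S (φ k) (Icc 0 1)) ∧
    ContDiff ℝ S ψ ∧ tsupport ψ ⊆ Icc (1 - (N : ℝ)) N ∧
    (∀ j ∈ Ico 0 (N : ℤ), ContDiffOn ℝ S (ψL j) (Ici 0) ∧ HasCompactSupport (ψL j)) ∧
    (∀ j ∈ Ico 0 (N : ℤ), ContDiffOn ℝ S (ψR j) (Ici 0) ∧ HasCompactSupport (ψR j)) ∧
    W = interval J₀ N M φ ψ ψL ψR ∧ W.IsONB ∧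
    (∀ m < S, ∀ l, W.J₀ ≤ l → ∀ k ∈ W.waveIdx l, ∫ x in W.T, x ^ m * W.ψ l k x = 0)

/-- `S`-regular wavelet bases of `L²(T)`, for `T = ℝ` or `T = [0,1]`. -/
def IsRegularBasis (S : ℕ) (W : WaveletSystem) : Prop :=
  W.IsLineBasis S ∨ W.IsIntervalBasis S

variable (W : WaveletSystem)

/-- The scaling coefficient `α_k(f) = ∫_T f φ_k`. -/
noncomputable def alpha (k : ℤ) (f : ℝ → ℝ) : ℝ := ∫ x in W.T, f x * W.φ k x

/-- The wavelet coefficient `β_{lk}(f) = ∫_T f ψ_{lk}`. -/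
noncomputable def beta (l : ℕ) (k : ℤ) (f : ℝ → ℝ) : ℝ := ∫ x in W.T, f x * W.ψ l k x

/-- The Hölder norm `max (sup_k |α_k(f)|, sup_{l,k} 2^{l(s+1/2)} |β_{lk}(f)|)`, possibly `∞`. -/
noncomputable def holderNorm (s : ℝ) (f : ℝ → ℝ) : ℝ≥0∞ :=
  max (⨆ k ∈ W.scalIdx, ENNReal.ofReal |W.alpha k f|)
    (⨆ (l : ℕ) (_ : W.J₀ ≤ l) (k ∈ W.waveIdx l),
      ENNReal.ofReal ((2 : ℝ) ^ ((l : ℝ) * (s + 1 / 2)) * |W.beta l k f|))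

/-- The sup-norm distance on `T`, possibly `∞`. -/
noncomputable def supDist (f g : ℝ → ℝ) : ℝ≥0∞ := ⨆ x ∈ W.T, ENNReal.ofReal |f x - g x|

/-- `inf_{g ∈ A} ‖f - g‖_∞`. -/
noncomputable def distTo (f : ℝ → ℝ) (A : Set (ℝ → ℝ)) : ℝ≥0∞ := ⨅ g ∈ A, W.supDist f g

/-- The wavelet projection `K_j(f) = ∑_k α_k(f) φ_k + ∑_{J₀ ≤ l < j} ∑_k β_{lk}(f) ψ_{lk}`
(at every point, only finitely many terms are non-zero for the bases above). -/
noncomputable def proj (j : ℕ) (f : ℝ → ℝ) (x : ℝ) : ℝ :=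
  (∑' k : W.scalIdx, W.alpha k f * W.φ k x) +
    ∑ l ∈ Finset.Ico W.J₀ j, ∑' k : W.waveIdx l, W.beta l k f * W.ψ l k x

/-- The class `Σ(s) = Σ(s, B)` of bounded continuous probability densities on `T` in the
Hölder ball of radius `B`. -/
def Sigma (B s : ℝ) : Set (ℝ → ℝ) :=
  {f | ContinuousOn f W.T ∧ (∃ M : ℝ, ∀ x ∈ W.T, |f x| ≤ M) ∧ (∀ x ∈ W.T, 0 ≤ f x) ∧
    ∫ x in W.T, f x = 1 ∧ W.holderNorm s f ≤ ENNReal.ofReal B}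

/-- The separated class `{f ∈ Σ(s) : inf_{g ∈ Σ(t)} ‖g - f‖_∞ ≥ ρ}`. -/
def tildeSigma (B s t ρ : ℝ) : Set (ℝ → ℝ) :=
  {f | f ∈ W.Sigma B s ∧ ENNReal.ofReal ρ ≤ W.distTo f (W.Sigma B t)}

/-- The analytic class
`{f ∈ Σ(s) : ε 2^{-ls} ≤ ‖K_l(f) - f‖_∞ ≤ B 2^{-ls} for all l ≥ ℓ}`. -/
def barSigma (B ε s : ℝ) (ℓ : ℕ) : Set (ℝ → ℝ) :=
  {f | f ∈ W.Sigma B s ∧ ∀ l : ℕ, ℓ ≤ l →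
    ENNReal.ofReal (ε * (2 : ℝ) ^ (-((l : ℝ) * s))) ≤ W.supDist (W.proj l f) f ∧
    W.supDist (W.proj l f) f ≤ ENNReal.ofReal (B * (2 : ℝ) ^ (-((l : ℝ) * s)))}

end WaveletSystem

/-- The rate `r_n(s) = (log n / n)^{s/(2s+1)}`. -/
noncomputable def minimaxRate (n : ℕ) (s : ℝ) : ℝ :=
  (Real.log n / n) ^ (s / (2 * s + 1))

/-- The growth condition `2^{-ℓ_n s} / r_n(s) → ∞`. -/
def GrowthCondition (ℓ : ℕ → ℕ) (s : ℝ) : Prop :=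
  Tendsto (fun n : ℕ => (2 : ℝ) ^ (-((ℓ n : ℝ) * s)) / minimaxRate n s) atTop atTop

/-! Everything is read off wavelet coefficients. Since $\|\psi_{lk}\|_1\lesssim 2^{-l/2}$, a
coefficient gap of size $b2^{-l/2}$ forces a sup-norm gap of order $b$ (`le_supDist`). Conversely,
at each point boundedly many wavelets of a level are nonzero, so small coefficients make a level
small in sup-norm (`abs_tsum_le`).

For (a), the lower bound on $\|K_l(f)-f\|_\infty$ and the upper bound on $\|K_{l+m}(f)-f\|_\infty$,
with $m$ fixed and large, keep $K_{l+m}(f)-K_l(f)$ from being small. Hence some coefficient with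
level in $[l,l+m)$ is at least $c2^{-i(s+1/2)}$ (`exists_large_beta`). Coefficients of
$g\in\Sigma(t)$ are at most $B2^{-i(t+1/2)}$, which is less than half of this a bounded number of
levels above $\ell$; the gap then gives the separation (`exists_le_distTo`).

For (b), one fixed function serves all $n$, $\varepsilon$ and $\ell_n$: a density $f_0$ of
regularity $S>s$ plus a single wavelet with coefficient of size $(B/2)2^{-l(s+1/2)}$
(`Localized.exists_separated`). That coefficient keeps it at a positive distance from $\Sigma(t)$,
while beyond level $l$ its coefficients decay too fast for the windows of (a). As $r_n(s)\to0$, the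
threshold depends only on that distance.

On $[0,1]$ the uniform density serves as $f_0$. On $\mathbb R$ it is a flattened bump, whose
coefficients decay because $\psi$ has $S$ vanishing moments; these follow from orthogonality and
smoothness (`moment_eq_zero_of_orthogonal`). -/

/-! ### Taylor expansion and vanishing moments -/

theorem abs_sub_taylorSum_le {f : ℝ → ℝ} {n : ℕ} {D : ℝ} (hf : ContDiff ℝ n f)
    (hD : ∀ x, |iteratedDeriv n f x| ≤ D) (x₀ x : ℝ) :
    |f x - ∑ i ∈ Finset.range n, iteratedDeriv i f x₀ / i.factorial * (x - x₀) ^ i|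
      ≤ D * |x - x₀| ^ n := by
  rcases n with _ | n
  · simpa using hD x
  have hD0 : 0 ≤ D := (abs_nonneg _).trans (hD 0)
  by_cases hx : x₀ = x
  · subst hx
    rw [Finset.sum_range_succ']
    simp
  obtain ⟨y, -, hy⟩ := taylor_mean_remainder_lagrange_iteratedDeriv (n := n) hx
    (by exact_mod_cast hf.contDiffOn)
  have hsum : taylorWithinEval f n (uIcc x₀ x) x₀ x =
      ∑ i ∈ Finset.range (n + 1), iteratedDeriv i f x₀ / i.factorial * (x - x₀) ^ i := by
    rw [taylor_within_apply]
    refine Finset.sum_congr rfl fun i hi => ?_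
    have hi' : i ≤ n + 1 := (Finset.mem_range.1 hi).le
    rw [iteratedDerivWithin_eq_iteratedDeriv (uniqueDiffOn_uIcc hx)
      (hf.contDiffAt.of_le (by exact_mod_cast hi')) left_mem_uIcc, smul_eq_mul]
    ring
  rw [← hsum, hy, abs_div, abs_mul, abs_pow, Nat.abs_cast]
  refine (div_le_self (by positivity) ?_).trans ?_
  · exact_mod_cast Nat.succ_le_of_lt (Nat.factorial_pos _)
  · gcongr
    exact hD y

theorem hasCompactSupport_of_abs_le {g : ℝ → ℝ} {R : ℝ} (hgs : ∀ y, g y ≠ 0 → |y| ≤ R) :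
    HasCompactSupport g :=
  HasCompactSupport.intro (isCompact_Icc (a := -R) (b := R)) fun y hy => by
    by_contra h
    exact hy (abs_le.1 (hgs y h))

/-- Taylor expansion in the scale `h`, with the moments of `g` as coefficients. It is used in both
directions: to deduce vanishing moments of the mother wavelet, and then to bound wavelet
coefficients of a smooth density. -/
theorem abs_integral_sub_taylorSum_le {f g : ℝ → ℝ} {n : ℕ} {D R : ℝ} (hf : ContDiff ℝ n f)
    (hD : ∀ x, |iteratedDeriv n f x| ≤ D) (hg : Continuous g)
    (hgs : ∀ y, g y ≠ 0 → |y| ≤ R) (x₀ h : ℝ) :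
    |(∫ y, f (x₀ + h * y) * g y) - ∑ i ∈ Finset.range n,
        iteratedDeriv i f x₀ / i.factorial * h ^ i * ∫ y, y ^ i * g y|
      ≤ D * (|h| * R) ^ n * ∫ y, |g y| := by
  have hgc := hasCompactSupport_of_abs_le hgs
  have hD0 : 0 ≤ D := (abs_nonneg _).trans (hD 0)
  have hfc : Continuous fun y => f (x₀ + h * y) := by
    have := hf.continuous
    fun_prop
  have hint : ∀ u : ℝ → ℝ, Continuous u → Integrable fun y => u y * g y := fun u hu =>
    (hu.mul hg).integrable_of_hasCompactSupport hgc.mul_left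
  have hsum : ∑ i ∈ Finset.range n, iteratedDeriv i f x₀ / i.factorial * h ^ i * ∫ y, y ^ i * g y
      = ∫ y, (∑ i ∈ Finset.range n, iteratedDeriv i f x₀ / i.factorial * (h * y) ^ i) * g y := by
    simp_rw [Finset.sum_mul]
    rw [integral_finsetSum _ fun i _ => hint _ (by fun_prop)]
    refine Finset.sum_congr rfl fun i _ => ?_
    rw [← integral_const_mul]
    congr 1
    ext y
    ring
  rw [hsum, ← integral_sub (hint _ hfc) (hint _ (by fun_prop)), ← integral_const_mul]
  refine (abs_integral_le_integral_abs).trans (integral_mono_of_nonneg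
    (Eventually.of_forall fun y => abs_nonneg _)
    (((hg.abs.integrable_of_hasCompactSupport
      (hgc.comp_left (g := fun z : ℝ => |z|) abs_zero))).const_mul _)
    (Eventually.of_forall fun y => ?_))
  simp only
  rw [← sub_mul, abs_mul]
  by_cases hy : g y = 0
  · simp [hy]
  have hyR := hgs y hy
  have h1 := abs_sub_taylorSum_le hf hD x₀ (x₀ + h * y)
  rw [add_sub_cancel_left] at h1
  refine mul_le_mul_of_nonneg_right (h1.trans ?_) (abs_nonneg _)
  rw [abs_mul]
  gcongr

theorem exists_iteratedDeriv_bound {g : ℝ → ℝ} {n : ℕ} (hg : ContDiff ℝ n g)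
    (hc : HasCompactSupport g) : ∃ D, ∀ x, |iteratedDeriv n g x| ≤ D := by
  obtain ⟨D, hD⟩ := (hc.iteratedFDeriv (𝕜 := ℝ) n).exists_bound_of_continuous
    (hg.continuous_iteratedFDeriv le_rfl)
  refine ⟨D, fun x => ?_⟩
  rw [← Real.norm_eq_abs, ← norm_iteratedFDeriv_eq_norm_iteratedDeriv]
  exact hD x

theorem tendsto_floor_dyadic (x : ℝ) :
    Tendsto (fun J : ℕ => (⌊(2 : ℝ) ^ J * x⌋ : ℝ) / 2 ^ J) atTop (nhds x) := by
  have h0 : Tendsto (fun J : ℕ => ((1 : ℝ) / 2) ^ J) atTop (nhds 0) :=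
    tendsto_pow_atTop_nhds_zero_of_lt_one (by norm_num) (by norm_num)
  refine tendsto_of_tendsto_of_tendsto_of_le_of_le (g := fun J : ℕ => x - (1 / 2) ^ J)
    (h := fun _ => x) (by simpa using tendsto_const_nhds.sub h0) tendsto_const_nhds
    (fun J => ?_) (fun J => ?_)
  · have := Int.lt_floor_add_one ((2 : ℝ) ^ J * x)
    simp only [one_div, inv_pow]
    rw [le_div_iff₀ (by positivity), sub_mul, inv_mul_cancel₀ (by positivity)]
    linarith
  · simp only
    rw [div_le_iff₀ (by positivity)]
    linarith [Int.floor_le ((2 : ℝ) ^ J * x)]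

/-- A smooth compactly supported function that is orthogonal to its finer dyadic wavelet
translates has vanishing moments. -/
theorem moment_eq_zero_of_orthogonal {S : ℕ} {ψ : ℝ → ℝ} {R : ℝ} (hψ : ContDiff ℝ S ψ)
    (hR : ∀ y, ψ y ≠ 0 → |y| ≤ R) (hne : ψ ≠ 0)
    (horth : ∀ j : ℕ, 0 < j → ∀ k : ℤ, ∫ x, ψ x * ψ (2 ^ j * x - k) = 0) :
    ∀ m < S, ∫ y, y ^ m * ψ y = 0 := by
  intro m
  induction m using Nat.strong_induction_on with
  | _ m ih =>
  intro hm
  by_contra hμ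
  have hψm : ContDiff ℝ (m + 1 : ℕ) ψ := hψ.of_le (by exact_mod_cast hm)
  obtain ⟨D, hD⟩ := exists_iteratedDeriv_bound hψm (hasCompactSupport_of_abs_le hR)
  -- For dyadic `x₀` and `j > J`, orthogonality reads ∫ ψ(x₀ + 2⁻ʲy) ψ(y) dy = 0. By induction only
  -- the `m`-th Taylor term survives, so it is O(2^(-j(m+1))). Dividing by 2^(-jm) and letting `j →
  -- ∞` gives ψ⁽ᵐ⁾(x₀) = 0, the `m`-th moment being nonzero.
  have hdyad : ∀ (K : ℤ) (J : ℕ), iteratedDeriv m ψ (K / 2 ^ J) = 0 := by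
    intro K J
    set x₀ : ℝ := K / 2 ^ J with hx₀
    have key : ∀ j : ℕ, J + 1 ≤ j →
        |iteratedDeriv m ψ x₀ / m.factorial * ∫ y, y ^ m * ψ y| ≤
          D * R ^ (m + 1) * (∫ y, |ψ y|) * (1 / 2) ^ j := by
      intro j hj
      have h1 := abs_integral_sub_taylorSum_le hψm hD hψ.continuous hR x₀ ((1 / 2) ^ j)
      have hz : ∫ y, ψ (x₀ + (1 / 2) ^ j * y) * ψ y = 0 := by
        obtain ⟨i, rfl⟩ := Nat.exists_eq_add_of_le (Nat.le_of_succ_le hj)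
        have h2 := horth (J + i) (by omega) (K * 2 ^ i)
        have h3 : ∀ y : ℝ, ψ (x₀ + (1 / 2) ^ (J + i) * y) * ψ y =
            (fun z => ψ (x₀ + z) * ψ (2 ^ (J + i) * (x₀ + z) - (K * 2 ^ i : ℤ)))
              ((1 / 2) ^ (J + i) * y) := by
          intro y
          simp only
          congr 2
          rw [hx₀]
          push_cast
          rw [one_div, inv_pow, pow_add]
          field_simp
          ring
        refine (integral_congr_ae (Eventually.of_forall h3)).trans ?_
        refine (Measure.integral_comp_mul_left (fun z => ψ (x₀ + z) *
          ψ (2 ^ (J + i) * (x₀ + z) - (K * 2 ^ i : ℤ))) _).trans ?_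
        rw [integral_add_left_eq_self (fun z => ψ z * ψ (2 ^ (J + i) * z - (K * 2 ^ i : ℤ))), h2,
          smul_zero]
      rw [hz, Finset.sum_range_succ, Finset.sum_eq_zero, zero_add, zero_sub, abs_neg] at h1
      · have hp : (0 : ℝ) < (1 / 2) ^ j := by positivity
        rw [abs_of_pos hp] at h1
        have e1 : |iteratedDeriv m ψ x₀ / m.factorial * ((1 / 2) ^ j) ^ m * ∫ y, y ^ m * ψ y| =
            |iteratedDeriv m ψ x₀ / m.factorial * ∫ y, y ^ m * ψ y| * ((1 / 2) ^ j) ^ m := by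
          rw [mul_right_comm, abs_mul, abs_of_pos (pow_pos hp m)]
        rw [e1] at h1
        refine le_of_mul_le_mul_right (h1.trans (le_of_eq ?_)) (pow_pos hp m)
        rw [mul_pow, pow_succ ((1 / 2 : ℝ) ^ j) m]
        ring
      · intro i hi
        rw [ih i (Finset.mem_range.1 hi) ((Finset.mem_range.1 hi).trans hm), mul_zero]
    have h0 : Tendsto (fun j : ℕ => D * R ^ (m + 1) * (∫ y, |ψ y|) * (1 / 2) ^ j) atTop
        (nhds 0) := by
      simpa using (tendsto_pow_atTop_nhds_zero_of_lt_one (r := (1 / 2 : ℝ)) (by norm_num)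
        (by norm_num)).const_mul (D * R ^ (m + 1) * (∫ y, |ψ y|))
    have h4 := ge_of_tendsto h0 (eventually_atTop.2 ⟨J + 1, key⟩)
    have h5 := abs_eq_zero.1 (le_antisymm h4 (abs_nonneg _))
    have h6 := (mul_eq_zero.1 h5).resolve_right hμ
    exact (div_eq_zero_iff.1 h6).resolve_right (by positivity)
  have hψm' : ContDiff ℝ m ψ := hψ.of_le (by exact_mod_cast hm.le)
  have hzero : ∀ x, iteratedDeriv m ψ x = 0 := by
    intro x
    have hc := (hψm'.continuous_iteratedDeriv m le_rfl).tendsto x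
    refine tendsto_nhds_unique (hc.comp (tendsto_floor_dyadic x)) ?_
    simp only [Function.comp_def, hdyad]
    exact tendsto_const_nhds
  refine hne (funext fun x => ?_)
  -- With zero `m`-th derivative, `ψ` equals its Taylor polynomial at `|R| + 1`, a point outside the
  -- support, where all coefficients vanish.
  have h7 := abs_sub_taylorSum_le hψm' (D := 0) (fun x => by simp [hzero x]) (|R| + 1) x
  rw [Finset.sum_eq_zero, sub_zero, zero_mul] at h7
  · exact abs_eq_zero.1 (le_antisymm h7 (abs_nonneg _))
  · intro i _
    have he : ψ =ᶠ[nhds (|R| + 1)] fun _ => 0 := by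
      filter_upwards [lt_mem_nhds (lt_add_one |R|)] with y hy
      by_contra h
      exact absurd (hR y h) (not_le.2 ((le_abs_self R).trans_lt (hy.trans_le (le_abs_self y))))
    rw [he.iteratedDeriv_eq i]
    simp

theorem eventually_two_rpow_neg_le {v e : ℝ} (hv : 0 < v) (he : 0 < e) :
    ∀ᶠ n : ℕ in atTop, (2 : ℝ) ^ (-((n : ℝ) * v)) ≤ e := by
  have h : Tendsto (fun n : ℕ => (2 : ℝ) ^ (-((n : ℝ) * v))) atTop (nhds 0) :=
    (tendsto_rpow_atBot_of_base_gt_one 2 one_lt_two).comp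
      (tendsto_neg_atTop_atBot.comp (tendsto_natCast_atTop_atTop.atTop_mul_const hv))
  exact h.eventually_le_const he

theorem two_rpow_neg_le_of_le {m n : ℕ} {v : ℝ} (hv : 0 ≤ v) (h : m ≤ n) :
    (2 : ℝ) ^ (-((n : ℝ) * v)) ≤ 2 ^ (-((m : ℝ) * v)) := by
  refine Real.rpow_le_rpow_of_exponent_le one_le_two (neg_le_neg ?_)
  gcongr

/-! ### Localization: wavelet coefficients against the sup-norm -/

namespace WaveletSystem

/-- The wavelets are continuous, and localized at scale `2⁻ˡ` with bounded overlap. -/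
structure Localized (W : WaveletSystem) (C : ℝ) (D : ℕ) : Prop where
  pos : 0 < C
  measurableSet : MeasurableSet W.T
  continuousOn : ∀ l k, W.J₀ ≤ l → k ∈ W.waveIdx l → ContinuousOn (W.ψ l k) W.T
  bound : ∀ l k, W.J₀ ≤ l → k ∈ W.waveIdx l → ∀ x ∈ W.T,
    |W.ψ l k x| ≤ C * 2 ^ ((l : ℝ) / 2)
  support : ∀ l k, W.J₀ ≤ l → k ∈ W.waveIdx l → ∃ a : ℝ, ∀ x ∈ W.T,
    W.ψ l k x ≠ 0 → |2 ^ l * x - a| ≤ C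
  overlap : ∀ l, W.J₀ ≤ l → ∀ x ∈ W.T, ∃ F : Finset ℤ, F.card ≤ D ∧
    ∀ k ∈ W.waveIdx l, W.ψ l k x ≠ 0 → k ∈ F

variable {W : WaveletSystem} {C : ℝ} {D : ℕ}

namespace Localized

/-- The support has length at most `2C / 2^l` and the height is at most `C 2^(l/2)`. -/
theorem integrableOn_and_integral_abs_le (h : W.Localized C D) {l : ℕ} {k : ℤ} (hl : W.J₀ ≤ l)
    (hk : k ∈ W.waveIdx l) : IntegrableOn (W.ψ l k) W.T ∧
      ∫ x in W.T, |W.ψ l k x| ≤ 2 * C ^ 2 * 2 ^ (-((l : ℝ) / 2)) := by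
  obtain ⟨a, ha⟩ := h.support l k hl hk
  have hC := h.pos
  have h2 : (0 : ℝ) < 2 ^ l := by positivity
  set I : Set ℝ := Icc ((a - C) / 2 ^ l) ((a + C) / 2 ^ l)
  set G : ℝ → ℝ := I.indicator fun _ => C * 2 ^ ((l : ℝ) / 2)
  have hGi : Integrable G := by
    rw [integrable_indicator_iff measurableSet_Icc]
    exact integrableOn_const (by simp)
  have hG0 : ∀ x, 0 ≤ G x := fun x => indicator_nonneg (fun _ _ => by positivity) x
  have hle : ∀ x ∈ W.T, |W.ψ l k x| ≤ G x := by
    intro x hx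
    by_cases h0 : W.ψ l k x = 0
    · simpa [h0] using hG0 x
    have h1 := abs_le.1 (ha x hx h0)
    have hxI : x ∈ I := by
      constructor
      · rw [div_le_iff₀ h2]; linarith
      · rw [le_div_iff₀ h2]; linarith
    simpa [G, indicator_of_mem hxI] using h.bound l k hl hk x hx
  have hae : ∀ᵐ x ∂volume.restrict W.T, |W.ψ l k x| ≤ G x :=
    (ae_restrict_iff' h.measurableSet).2 (Eventually.of_forall hle)
  refine ⟨hGi.integrableOn.mono' ((h.continuousOn l k hl hk).aestronglyMeasurable
    h.measurableSet) hae, ?_⟩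
  calc ∫ x in W.T, |W.ψ l k x| ≤ ∫ x in W.T, G x :=
        integral_mono_of_nonneg (Eventually.of_forall fun x => abs_nonneg _) hGi.integrableOn hae
    _ ≤ ∫ x, G x := setIntegral_le_integral hGi (Eventually.of_forall hG0)
    _ = 2 * C / 2 ^ l * (C * 2 ^ ((l : ℝ) / 2)) := by
        rw [integral_indicator_const _ measurableSet_Icc, smul_eq_mul, Real.volume_real_Icc_of_le]
        · congr 1
          ring
        · gcongr
          linarith
    _ = 2 * C ^ 2 * 2 ^ (-((l : ℝ) / 2)) := by
        have e : (2 : ℝ) ^ ((l : ℝ) / 2) = 2 ^ l * 2 ^ (-((l : ℝ) / 2)) := by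
          rw [← Real.rpow_natCast, ← Real.rpow_add two_pos]
          ring_nf
        rw [e]
        field_simp

theorem integrable_mul_wavelet (h : W.Localized C D) {l : ℕ} {k : ℤ} (hl : W.J₀ ≤ l)
    (hk : k ∈ W.waveIdx l) {f : ℝ → ℝ} (hf : ContinuousOn f W.T) {M : ℝ}
    (hM : ∀ x ∈ W.T, |f x| ≤ M) : IntegrableOn (fun x => f x * W.ψ l k x) W.T :=
  (h.integrableOn_and_integral_abs_le hl hk).1.bdd_mul (hf.aestronglyMeasurable h.measurableSet)
    ((ae_restrict_iff' h.measurableSet).2 (Eventually.of_forall hM))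

theorem abs_beta_sub_le (h : W.Localized C D) {l : ℕ} {k : ℤ} (hl : W.J₀ ≤ l)
    (hk : k ∈ W.waveIdx l) {f g : ℝ → ℝ} (hf : ContinuousOn f W.T) (hg : ContinuousOn g W.T)
    (hfM : ∃ M : ℝ, ∀ x ∈ W.T, |f x| ≤ M) (hgM : ∃ M : ℝ, ∀ x ∈ W.T, |g x| ≤ M) {e : ℝ}
    (he : ∀ x ∈ W.T, |f x - g x| ≤ e) (he0 : 0 ≤ e) :
    |W.beta l k f - W.beta l k g| ≤ e * (2 * C ^ 2 * 2 ^ (-((l : ℝ) / 2))) := by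
  obtain ⟨M, hM⟩ := hfM
  obtain ⟨N, hN⟩ := hgM
  obtain ⟨hi, hb⟩ := h.integrableOn_and_integral_abs_le hl hk
  unfold beta
  rw [← integral_sub (h.integrable_mul_wavelet hl hk hf hM) (h.integrable_mul_wavelet hl hk hg hN)]
  refine abs_integral_le_integral_abs.trans ?_
  refine (integral_mono_of_nonneg (Eventually.of_forall fun x => abs_nonneg _)
    (hi.abs.const_mul e) ?_).trans ?_
  · refine (ae_restrict_iff' h.measurableSet).2 (Eventually.of_forall fun x hx => ?_)
    simp only
    rw [← sub_mul, abs_mul]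
    exact mul_le_mul_of_nonneg_right (he x hx) (abs_nonneg _)
  · rw [integral_const_mul]
    exact mul_le_mul_of_nonneg_left hb he0

/-- Duality between the sup-norm and L¹: the coefficient gap is at most the distance times the L¹
norm of the wavelet. The factor `2^(-l/2)` cancels, so the bound does not depend on the level. -/
theorem le_supDist (h : W.Localized C D) {l : ℕ} {k : ℤ} (hl : W.J₀ ≤ l)
    (hk : k ∈ W.waveIdx l) {f g : ℝ → ℝ} (hf : ContinuousOn f W.T) (hg : ContinuousOn g W.T)
    (hfM : ∃ M : ℝ, ∀ x ∈ W.T, |f x| ≤ M) (hgM : ∃ M : ℝ, ∀ x ∈ W.T, |g x| ≤ M) {b : ℝ}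
    (hb : b * 2 ^ (-((l : ℝ) / 2)) ≤ |W.beta l k f - W.beta l k g|) :
    ENNReal.ofReal (b / (2 * C ^ 2)) ≤ W.supDist f g := by
  by_cases htop : W.supDist f g = ⊤
  · simp [htop]
  have hC := h.pos
  rw [← ENNReal.ofReal_toReal htop]
  refine ENNReal.ofReal_le_ofReal ?_
  have h1 : ∀ x ∈ W.T, |f x - g x| ≤ (W.supDist f g).toReal := by
    intro x hx
    rw [← ENNReal.ofReal_le_iff_le_toReal htop]
    exact le_iSup₂ (f := fun x (_ : x ∈ W.T) => ENNReal.ofReal |f x - g x|) x hx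
  have h2 := hb.trans (h.abs_beta_sub_le hl hk hf hg hfM hgM h1 ENNReal.toReal_nonneg)
  rw [div_le_iff₀ (by positivity)]
  refine le_of_mul_le_mul_right (h2.trans (le_of_eq ?_))
    (Real.rpow_pos_of_pos two_pos (-((l : ℝ) / 2)))
  ring

theorem abs_tsum_le (h : W.Localized C D) {l : ℕ} (hl : W.J₀ ≤ l) {x : ℝ} (hx : x ∈ W.T)
    {b : ℤ → ℝ} {A : ℝ} (hA : 0 ≤ A) (hb : ∀ k ∈ W.waveIdx l, |b k| ≤ A) :
    |∑' k : W.waveIdx l, b k * W.ψ l k x| ≤ D * (A * (C * 2 ^ ((l : ℝ) / 2))) := by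
  obtain ⟨F, hF, hFk⟩ := h.overlap l hl x hx
  have hC := h.pos
  rw [tsum_subtype (W.waveIdx l) fun k => b k * W.ψ l k x, tsum_eq_sum (s := F)]
  · refine (Finset.abs_sum_le_sum_abs _ _).trans ((Finset.sum_le_card_nsmul F _
      (A * (C * 2 ^ ((l : ℝ) / 2))) fun k _ => ?_).trans ?_)
    · by_cases hk : k ∈ W.waveIdx l
      · rw [indicator_of_mem hk, abs_mul]
        exact mul_le_mul (hb k hk) (h.bound l k hl hk x hx) (abs_nonneg _) hA
      · rw [indicator_of_notMem hk, abs_zero]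
        positivity
    · rw [nsmul_eq_mul]
      gcongr
  · intro k hk
    by_cases hkm : k ∈ W.waveIdx l
    · rw [indicator_of_mem hkm]
      by_contra h0
      exact hk (hFk k hkm (right_ne_zero_of_mul h0))
    · exact indicator_of_notMem hkm _

end Localized

/-! ### Large coefficients in windows of levels, and separation -/

theorem proj_sub_proj {l m : ℕ} (hl : W.J₀ ≤ l) (hlm : l ≤ m) (f : ℝ → ℝ) (x : ℝ) :
    W.proj m f x - W.proj l f x =
      ∑ i ∈ Finset.Ico l m, ∑' k : W.waveIdx i, W.beta i k f * W.ψ i k x := by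
  unfold proj
  rw [← Finset.sum_Ico_consecutive _ hl hlm]
  ring

theorem abs_sub_le_of_supDist_le {f g : ℝ → ℝ} {e : ℝ} (he : 0 ≤ e)
    (h : W.supDist f g ≤ ENNReal.ofReal e) {x : ℝ} (hx : x ∈ W.T) : |f x - g x| ≤ e := by
  rw [← ENNReal.ofReal_le_ofReal_iff he]
  exact (le_iSup₂ (f := fun x (_ : x ∈ W.T) => ENNReal.ofReal |f x - g x|) x hx).trans h

theorem supDist_le {f g : ℝ → ℝ} {e : ℝ} (h : ∀ x ∈ W.T, |f x - g x| ≤ e) :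
    W.supDist f g ≤ ENNReal.ofReal e :=
  iSup₂_le fun x hx => ENNReal.ofReal_le_ofReal (h x hx)

/-- Members of `barSigma` have a large wavelet coefficient in every window of levels of a fixed
length. -/
theorem Localized.exists_large_beta (h : W.Localized C D) {B ε s : ℝ} (hB : 0 < B) (hε : 0 < ε)
    (hs : 0 < s) : ∃ (m : ℕ) (c : ℝ), 0 < c ∧ ∀ ℓ : ℕ, ∀ f ∈ W.barSigma B ε s ℓ, ∀ l,
      ℓ ≤ l → W.J₀ ≤ l → ∃ i ∈ Finset.Ico l (l + m), ∃ k ∈ W.waveIdx i,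
        c * 2 ^ (-((i : ℝ) * (s + 1 / 2))) ≤ |W.beta i k f| := by
  have hC := h.pos
  obtain ⟨m, hm⟩ := (eventually_two_rpow_neg_le hs (e := ε / (4 * B)) (by positivity)).exists
  refine ⟨m, ε / (4 * (m + 1) * (D + 1) * C), by positivity, ?_⟩
  intro ℓ f hf l hℓ hl
  by_contra! hcon
  set c := ε / (4 * (m + 1) * (D + 1) * C) with hc
  have hc0 : 0 < c := by positivity
  set q : ℝ := 2 ^ (-((l : ℝ) * s)) with hq
  have hq0 : 0 < q := by positivity
  have hx : ∀ x ∈ W.T, |W.proj l f x - f x| ≤ ε / 2 * q := by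
    intro x hx
    have h1 : |W.proj (l + m) f x - W.proj l f x| ≤ ε / 4 * q := by
      rw [proj_sub_proj hl (Nat.le_add_right l m)]
      refine (Finset.abs_sum_le_sum_abs _ _).trans ((Finset.sum_le_card_nsmul _ _
        (D * (c * C) * q) fun i hi => ?_).trans ?_)
      · have hli := (Finset.mem_Ico.1 hi).1
        refine (h.abs_tsum_le (hl.trans hli) hx (A := c * 2 ^ (-((i : ℝ) * (s + 1 / 2))))
          (by positivity) fun k hk => (hcon i hi k hk).le).trans ?_
        have e : c * (2 : ℝ) ^ (-((i : ℝ) * (s + 1 / 2))) * (C * 2 ^ ((i : ℝ) / 2)) =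
            c * C * 2 ^ (-((i : ℝ) * s)) := by
          have : (2 : ℝ) ^ (-((i : ℝ) * s)) =
              2 ^ (-((i : ℝ) * (s + 1 / 2))) * 2 ^ ((i : ℝ) / 2) := by
            rw [← Real.rpow_add two_pos]
            ring_nf
          rw [this]
          ring
        rw [e, mul_assoc (D : ℝ)]
        have := two_rpow_neg_le_of_le hs.le hli
        gcongr
      · rw [Nat.card_Ico, Nat.add_sub_cancel_left, nsmul_eq_mul, ← mul_assoc]
        refine mul_le_mul_of_nonneg_right ?_ hq0.le
        have e : ε / 4 = (m + 1) * ((D + 1) * (c * C)) := by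
          rw [hc]
          field_simp
        rw [e]
        gcongr <;> linarith
    have h2 : |W.proj (l + m) f x - f x| ≤ ε / 4 * q := by
      refine (abs_sub_le_of_supDist_le (by positivity) (hf.2 (l + m) (by omega)).2 hx).trans ?_
      have e : (2 : ℝ) ^ (-(((l + m : ℕ) : ℝ) * s)) = 2 ^ (-((m : ℝ) * s)) * q := by
        rw [hq, ← Real.rpow_add two_pos]
        push_cast
        ring_nf
      rw [e, ← mul_assoc]
      refine mul_le_mul_of_nonneg_right ?_ hq0.le
      calc B * 2 ^ (-((m : ℝ) * s)) ≤ B * (ε / (4 * B)) := by gcongr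
        _ = ε / 4 := by field_simp
    rw [abs_le] at h1 h2 ⊢
    constructor <;> linarith
  have h3 := (hf.2 l hℓ).1.trans (supDist_le hx)
  rw [ENNReal.ofReal_le_ofReal_iff (by positivity)] at h3
  have : 0 < ε * q := by positivity
  linarith

theorem abs_beta_le_of_mem_Sigma {B u : ℝ} (hB : 0 ≤ B) {f : ℝ → ℝ} (hf : f ∈ W.Sigma B u)
    {l : ℕ} {k : ℤ} (hl : W.J₀ ≤ l) (hk : k ∈ W.waveIdx l) :
    |W.beta l k f| ≤ B * 2 ^ (-((l : ℝ) * (u + 1 / 2))) := by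
  have h1 : ENNReal.ofReal ((2 : ℝ) ^ ((l : ℝ) * (u + 1 / 2)) * |W.beta l k f|) ≤
      ENNReal.ofReal B := by
    refine le_trans ?_ ((le_max_right _ _).trans hf.2.2.2.2)
    exact (le_iSup₂ (f := fun k (_ : k ∈ W.waveIdx l) =>
      ENNReal.ofReal ((2 : ℝ) ^ ((l : ℝ) * (u + 1 / 2)) * |W.beta l k f|)) k hk).trans
      (le_iSup₂ (f := fun l (_ : W.J₀ ≤ l) => ⨆ k ∈ W.waveIdx l,
        ENNReal.ofReal ((2 : ℝ) ^ ((l : ℝ) * (u + 1 / 2)) * |W.beta l k f|)) l hl)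
  rw [ENNReal.ofReal_le_ofReal_iff hB] at h1
  rw [Real.rpow_neg two_pos.le, ← div_eq_mul_inv, le_div_iff₀ (by positivity), mul_comm]
  exact h1

theorem holderNorm_le {B u : ℝ} {f : ℝ → ℝ} (hα : ∀ k ∈ W.scalIdx, |W.alpha k f| ≤ B)
    (hβ : ∀ l k, W.J₀ ≤ l → k ∈ W.waveIdx l →
      |W.beta l k f| ≤ B * 2 ^ (-((l : ℝ) * (u + 1 / 2)))) :
    W.holderNorm u f ≤ ENNReal.ofReal B := by
  refine max_le (iSup₂_le fun k hk => ENNReal.ofReal_le_ofReal (hα k hk))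
    (iSup₂_le fun l hl => iSup₂_le fun k hk => ENNReal.ofReal_le_ofReal ?_)
  have h1 := hβ l k hl hk
  rwa [Real.rpow_neg two_pos.le, ← div_eq_mul_inv, le_div_iff₀ (by positivity), mul_comm] at h1

/-- Members of `barSigma` are separated from smoother Hölder balls. -/
theorem Localized.exists_le_distTo (h : W.Localized C D) {B ε s t : ℝ} (hB : 0 < B) (hε : 0 < ε)
    (hs : 0 < s) (hst : s < t) : ∃ c : ℝ, 0 < c ∧ ∀ ℓ : ℕ, ∀ f ∈ W.barSigma B ε s ℓ,
      ENNReal.ofReal (c * (2 : ℝ) ^ (-((ℓ : ℝ) * s))) ≤ W.distTo f (W.Sigma B t) := by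
  have hC := h.pos
  obtain ⟨m, c, hc, hA⟩ := h.exists_large_beta hB hε hs
  -- From level `ℓ + p` on, coefficients of `g ∈ Σ(t)` are at most half the large coefficient of
  -- `f`. The large coefficient lies below level `ℓ + p + m`, which costs the factor `2^(-(p+m)s)`
  -- in the constant.
  obtain ⟨p, hp, hpJ⟩ := ((eventually_two_rpow_neg_le (sub_pos.2 hst) (e := c / (2 * B))
    (by positivity)).and (eventually_ge_atTop W.J₀)).exists
  refine ⟨c / 2 * 2 ^ (-(((p + m : ℕ) : ℝ) * s)) / (2 * C ^ 2), by positivity, ?_⟩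
  intro ℓ f hf
  refine le_iInf₂ fun g hg => ?_
  obtain ⟨i, hi, k, hk, hik⟩ := hA ℓ f hf (ℓ + p) (by omega) (by omega)
  rw [Finset.mem_Ico] at hi
  have hiJ : W.J₀ ≤ i := by omega
  have hg1 := abs_beta_le_of_mem_Sigma hB.le hg hiJ hk
  rw [div_mul_eq_mul_div]
  refine h.le_supDist hiJ hk hf.1.1 hg.1 hf.1.2.1 hg.2.1 ?_
  have e1 : (2 : ℝ) ^ (-((i : ℝ) * (t + 1 / 2))) =
      2 ^ (-((i : ℝ) * (t - s))) * 2 ^ (-((i : ℝ) * (s + 1 / 2))) := by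
    rw [← Real.rpow_add two_pos]
    ring_nf
  have e2 : (2 : ℝ) ^ (-((i : ℝ) * (s + 1 / 2))) =
      2 ^ (-((i : ℝ) * s)) * 2 ^ (-((i : ℝ) / 2)) := by
    rw [← Real.rpow_add two_pos]
    ring_nf
  have e3 : (2 : ℝ) ^ (-(((p + m : ℕ) : ℝ) * s)) * 2 ^ (-((ℓ : ℝ) * s)) =
      2 ^ (-(((ℓ + p + m : ℕ) : ℝ) * s)) := by
    rw [← Real.rpow_add two_pos]
    push_cast
    ring_nf
  have h1 : |W.beta i k g| ≤ c / 2 * 2 ^ (-((i : ℝ) * (s + 1 / 2))) := by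
    refine hg1.trans ?_
    rw [e1, ← mul_assoc]
    gcongr
    calc B * 2 ^ (-((i : ℝ) * (t - s))) ≤ B * (c / (2 * B)) := by
          gcongr
          exact (two_rpow_neg_le_of_le (sub_pos.2 hst).le (by omega)).trans hp
      _ = c / 2 := by field_simp
  have h2 := abs_sub_abs_le_abs_sub (W.beta i k f) (W.beta i k g)
  have h3 : (2 : ℝ) ^ (-(((ℓ + p + m : ℕ) : ℝ) * s)) ≤ 2 ^ (-((i : ℝ) * s)) :=
    two_rpow_neg_le_of_le hs.le hi.2.le
  rw [mul_assoc (c / 2), e3]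
  calc c / 2 * 2 ^ (-(((ℓ + p + m : ℕ) : ℝ) * s)) * 2 ^ (-((i : ℝ) / 2))
      ≤ c / 2 * 2 ^ (-((i : ℝ) * s)) * 2 ^ (-((i : ℝ) / 2)) := by gcongr
    _ = c / 2 * 2 ^ (-((i : ℝ) * (s + 1 / 2))) := by rw [e2]; ring
    _ ≤ _ := by linarith

end WaveletSystem

/-! ### Orthonormality and the perturbed density -/

namespace WaveletSystem

variable {W : WaveletSystem} {C : ℝ} {D : ℕ}

theorem IsONB.memLp_member (h : W.IsONB) (i : W.Idx) :
    MemLp (W.member i) 2 (volume.restrict W.T) := by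
  obtain ⟨b, hb⟩ := h
  exact MemLp.ae_eq (hb i) (Lp.memLp (b i))

open Classical in
theorem IsONB.integral_member_mul (h : W.IsONB) (i j : W.Idx) :
    ∫ x in W.T, W.member i x * W.member j x = if i = j then 1 else 0 := by
  obtain ⟨b, hb⟩ := h
  rw [← orthonormal_iff_ite.1 b.orthonormal i j, L2.inner_def]
  refine integral_congr_ae ?_
  filter_upwards [hb i, hb j] with x hi hj
  rw [← hi, ← hj]
  simp [mul_comm]

theorem IsONB.memLp_scaling (h : W.IsONB) {k : ℤ} (hk : k ∈ W.scalIdx) :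
    MemLp (W.φ k) 2 (volume.restrict W.T) :=
  h.memLp_member (Sum.inl ⟨k, hk⟩)

theorem IsONB.memLp_wavelet (h : W.IsONB) {l : ℕ} {k : ℤ} (hl : W.J₀ ≤ l)
    (hk : k ∈ W.waveIdx l) : MemLp (W.ψ l k) 2 (volume.restrict W.T) :=
  h.memLp_member (Sum.inr ⟨(l, k), hl, hk⟩)

theorem IsONB.integral_scaling_mul_self (h : W.IsONB) {k : ℤ} (hk : k ∈ W.scalIdx) :
    ∫ x in W.T, W.φ k x * W.φ k x = 1 := by
  simpa [member] using h.integral_member_mul (Sum.inl ⟨k, hk⟩) (Sum.inl ⟨k, hk⟩)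

theorem IsONB.integral_wavelet_mul_scaling (h : W.IsONB) {k : ℤ} (hk : k ∈ W.scalIdx) {l : ℕ}
    {k' : ℤ} (hl : W.J₀ ≤ l) (hk' : k' ∈ W.waveIdx l) :
    ∫ x in W.T, W.ψ l k' x * W.φ k x = 0 := by
  simpa [member] using h.integral_member_mul (Sum.inr ⟨(l, k'), hl, hk'⟩) (Sum.inl ⟨k, hk⟩)

theorem IsONB.integral_wavelet_mul_wavelet (h : W.IsONB) {l l' : ℕ} {k k' : ℤ} (hl : W.J₀ ≤ l)
    (hk : k ∈ W.waveIdx l) (hl' : W.J₀ ≤ l') (hk' : k' ∈ W.waveIdx l') :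
    ∫ x in W.T, W.ψ l k x * W.ψ l' k' x = if l = l' ∧ k = k' then 1 else 0 := by
  have := h.integral_member_mul (Sum.inr ⟨(l, k), hl, hk⟩) (Sum.inr ⟨(l', k'), hl', hk'⟩)
  simpa [member] using this

/-- Perturbing a sufficiently regular density by a single wavelet gives a density that is separated
from the smoother Hölder ball and belongs to no class `barSigma`. -/
theorem Localized.exists_separated (h : W.Localized C D) (hO : W.IsONB) {B s t u : ℝ} (hB : 0 < B)
    (hs : 0 < s) (hst : s < t) (hsu : s < u) {f₀ : ℝ → ℝ} {c₀ M : ℝ} (hc₀ : 0 < c₀)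
    (hcont : ContinuousOn f₀ W.T) (hM : ∀ x ∈ W.T, |f₀ x| ≤ M)
    (hL2 : MemLp f₀ 2 (volume.restrict W.T)) (h0 : ∀ x ∈ W.T, 0 ≤ f₀ x)
    (h1 : ∫ x in W.T, f₀ x = 1) (hα : ∀ k ∈ W.scalIdx, |W.alpha k f₀| ≤ B)
    (hβ : ∀ l k, W.J₀ ≤ l → k ∈ W.waveIdx l →
      |W.beta l k f₀| ≤ B / 2 * 2 ^ (-((l : ℝ) * (u + 1 / 2))))
    (hloc : ∀ l, W.J₀ ≤ l → ∃ k ∈ W.waveIdx l, ∫ x in W.T, W.ψ l k x = 0 ∧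
      ∀ x ∈ W.T, W.ψ l k x ≠ 0 → c₀ ≤ f₀ x) :
    ∃ f ∈ W.Sigma B s, (∃ d : ℝ, 0 < d ∧ ENNReal.ofReal d ≤ W.distTo f (W.Sigma B t)) ∧
      ∀ ε : ℝ, 0 < ε → ∀ ℓ : ℕ, f ∉ W.barSigma B ε s ℓ := by
  have hC := h.pos
  -- The first condition bounds the perturbation by `c₀`, so that the density stays nonnegative; the
  -- second makes coefficients of `Σ(t)` at level `l` at most half of the perturbed one.
  obtain ⟨l, hl₁, hl₂, hl⟩ := ((eventually_two_rpow_neg_le hs (e := c₀ / (B / 2 * C))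
    (by positivity)).and ((eventually_two_rpow_neg_le (sub_pos.2 hst) (e := 1 / 4)
    (by positivity)).and (eventually_ge_atTop W.J₀))).exists
  obtain ⟨k, hk, hψ0, hψ⟩ := hloc l hl
  set w : ℕ → ℝ := fun i => 2 ^ (-((i : ℝ) * (s + 1 / 2))) with hw
  have hw0 : ∀ i, 0 < w i := fun i => by positivity
  have hβs : ∀ i k, W.J₀ ≤ i → k ∈ W.waveIdx i → |W.beta i k f₀| ≤ B / 2 * w i := by
    intro i k hi hk
    refine (hβ i k hi hk).trans (mul_le_mul_of_nonneg_left ?_ (by positivity))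
    refine Real.rpow_le_rpow_of_exponent_le one_le_two (neg_le_neg ?_)
    gcongr
  -- The sign of `a` agrees with that of the coefficient of `f₀`, which excludes cancellation.
  obtain ⟨a, ha, hab⟩ : ∃ a : ℝ, |a| = B / 2 * w l ∧ B / 2 * w l ≤ |W.beta l k f₀ + a| := by
    have hA : 0 < B / 2 * w l := mul_pos (by positivity) (hw0 l)
    rcases le_total 0 (W.beta l k f₀) with h2 | h2
    · exact ⟨B / 2 * w l, abs_of_pos hA, by rw [abs_of_nonneg (by linarith)]; linarith⟩
    · exact ⟨-(B / 2 * w l), by rw [abs_neg, abs_of_pos hA], by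
        rw [abs_of_nonpos (by linarith)]; linarith⟩
  set f : ℝ → ℝ := fun x => f₀ x + a * W.ψ l k x with hf
  have hψL2 := hO.memLp_wavelet hl hk
  have hψi := (h.integrableOn_and_integral_abs_le hl hk).1
  have hfα : ∀ k' ∈ W.scalIdx, W.alpha k' f = W.alpha k' f₀ := by
    intro k' hk'
    have hφ := hO.memLp_scaling hk'
    have i1 : Integrable (fun x => f₀ x * W.φ k' x) (volume.restrict W.T) := hL2.integrable_mul hφ
    have i2 : Integrable (fun x => W.ψ l k x * W.φ k' x) (volume.restrict W.T) :=
      hψL2.integrable_mul hφ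
    have e : ∀ x, f x * W.φ k' x = f₀ x * W.φ k' x + a * (W.ψ l k x * W.φ k' x) := by
      intro x
      simp only [hf]
      ring
    unfold alpha
    simp_rw [e]
    rw [integral_add i1 (i2.const_mul a), integral_const_mul,
      hO.integral_wavelet_mul_scaling hk' hl hk, mul_zero, add_zero]
  have hfβ : ∀ l' k', W.J₀ ≤ l' → k' ∈ W.waveIdx l' →
      W.beta l' k' f = W.beta l' k' f₀ + a * if l = l' ∧ k = k' then 1 else 0 := by
    intro l' k' hl' hk'
    have hψ' := hO.memLp_wavelet hl' hk'
    have i1 : Integrable (fun x => f₀ x * W.ψ l' k' x) (volume.restrict W.T) :=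
      hL2.integrable_mul hψ'
    have i2 : Integrable (fun x => W.ψ l k x * W.ψ l' k' x) (volume.restrict W.T) :=
      hψL2.integrable_mul hψ'
    have e : ∀ x, f x * W.ψ l' k' x = f₀ x * W.ψ l' k' x + a * (W.ψ l k x * W.ψ l' k' x) := by
      intro x
      simp only [hf]
      ring
    unfold beta
    simp_rw [e]
    rw [integral_add i1 (i2.const_mul a), integral_const_mul,
      hO.integral_wavelet_mul_wavelet hl hk hl' hk']
  have haψ : ∀ x ∈ W.T, |a * W.ψ l k x| ≤ c₀ := by
    intro x hx
    rw [abs_mul, ha]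
    have e : w l * 2 ^ ((l : ℝ) / 2) = 2 ^ (-((l : ℝ) * s)) := by
      rw [hw, ← Real.rpow_add two_pos]
      ring_nf
    calc B / 2 * w l * |W.ψ l k x| ≤ B / 2 * w l * (C * 2 ^ ((l : ℝ) / 2)) :=
          mul_le_mul_of_nonneg_left (h.bound l k hl hk x hx) (mul_pos (by positivity) (hw0 l)).le
      _ = B / 2 * C * (w l * 2 ^ ((l : ℝ) / 2)) := by ring
      _ ≤ B / 2 * C * (c₀ / (B / 2 * C)) := by rw [e]; gcongr
      _ = c₀ := by field_simp
  have hfc : ContinuousOn f W.T := hcont.add ((h.continuousOn l k hl hk).const_mul a)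
  have hfM : ∃ M : ℝ, ∀ x ∈ W.T, |f x| ≤ M :=
    ⟨M + c₀, fun x hx => (abs_add_le _ _).trans (add_le_add (hM x hx) (haψ x hx))⟩
  have hf0i : IntegrableOn f₀ W.T := by
    -- The integral of a non-integrable function is 0 by convention, so the value 1 forces
    -- integrability.
    by_contra hn
    rw [integral_undef hn] at h1
    exact zero_ne_one h1
  have hfS : f ∈ W.Sigma B s := by
    refine ⟨hfc, hfM, fun x hx => ?_, ?_, holderNorm_le (fun k' hk' => ?_)
      fun l' k' hl' hk' => ?_⟩
    · by_cases hz : W.ψ l k x = 0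
      · simpa [hf, hz] using h0 x hx
      · have h2 := hψ x hx hz
        have h3 := (abs_le.1 (haψ x hx)).1
        simp only [hf]
        linarith
    · simp only [hf]
      rw [integral_add hf0i (hψi.const_mul a), integral_const_mul, hψ0, h1]
      simp
    · rw [hfα k' hk']
      exact hα k' hk'
    · rw [hfβ l' k' hl' hk']
      split_ifs with he
      · obtain ⟨rfl, rfl⟩ := he
        rw [mul_one]
        have := abs_add_le (W.beta l k f₀) a
        have := hβs l k hl hk
        change _ ≤ B * w l
        linarith
      · rw [mul_zero, add_zero]
        refine (hβs l' k' hl' hk').trans ?_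
        have := mul_pos hB (hw0 l')
        change _ ≤ B * w l'
        linarith
  refine ⟨f, hfS, ⟨B / 4 * 2 ^ (-((l : ℝ) * s)) / (2 * C ^ 2), by positivity, ?_⟩, ?_⟩
  · refine le_iInf₂ fun g hg => h.le_supDist hl hk hfc hg.1 hfM hg.2.1 ?_
    have hg1 := abs_beta_le_of_mem_Sigma hB.le hg hl hk
    have e1 : (2 : ℝ) ^ (-((l : ℝ) * (t + 1 / 2))) = 2 ^ (-((l : ℝ) * (t - s))) * w l := by
      rw [hw, ← Real.rpow_add two_pos]
      ring_nf
    have e2 : (2 : ℝ) ^ (-((l : ℝ) * s)) * 2 ^ (-((l : ℝ) / 2)) = w l := by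
      rw [hw, ← Real.rpow_add two_pos]
      ring_nf
    rw [mul_assoc, e2]
    have h2 : |W.beta l k g| ≤ B / 4 * w l := by
      refine hg1.trans ?_
      rw [e1, ← mul_assoc]
      refine mul_le_mul_of_nonneg_right ?_ (hw0 l).le
      calc B * 2 ^ (-((l : ℝ) * (t - s))) ≤ B * (1 / 4) := by gcongr
        _ = B / 4 := by ring
    have h3 : B / 2 * w l ≤ |W.beta l k f| := by
      rw [hfβ l k hl hk]
      simpa using hab
    have := abs_sub_abs_le_abs_sub (W.beta l k f) (W.beta l k g)
    linarith
  · intro ε hε ℓ hfb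
    obtain ⟨m, c, hc, hA⟩ := h.exists_large_beta hB hε hs
    obtain ⟨p, hp⟩ := (eventually_two_rpow_neg_le (sub_pos.2 hsu) (e := c / B)
      (by positivity)).exists
    -- The window starts above `l`, where `f` and `f₀` have the same coefficients, and above `p`,
    -- where the decay with exponent `u > s` undercuts the lower bound `c`.
    obtain ⟨i, hi, k', hk', hik⟩ := hA ℓ f hfb (ℓ + p + W.J₀ + (l + 1)) (by omega) (by omega)
    rw [Finset.mem_Ico] at hi
    have hiJ : W.J₀ ≤ i := by omega
    rw [hfβ i k' hiJ hk', if_neg (by omega), mul_zero, add_zero] at hik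
    have e1 : (2 : ℝ) ^ (-((i : ℝ) * (u + 1 / 2))) = 2 ^ (-((i : ℝ) * (u - s))) * w i := by
      rw [hw, ← Real.rpow_add two_pos]
      ring_nf
    have h2 := hik.trans (hβ i k' hiJ hk')
    rw [e1, ← mul_assoc] at h2
    have h3 := le_of_mul_le_mul_right h2 (hw0 i)
    have h4 : B / 2 * 2 ^ (-((i : ℝ) * (u - s))) ≤ B / 2 * (c / B) := by
      gcongr
      exact (two_rpow_neg_le_of_le (sub_pos.2 hsu).le (by omega)).trans hp
    have h5 : B / 2 * (c / B) = c / 2 := by field_simp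
    linarith

end WaveletSystem

/-! ### Compact supports, dyadic scaling and a bump density -/

theorem eventually_abs_le_and_support {g : ℝ → ℝ} {s : Set ℝ} (hs : IsClosed s)
    (hg : ContinuousOn g s) (hc : HasCompactSupport g) :
    ∀ᶠ C : ℝ in atTop, ∀ y ∈ s, |g y| ≤ C ∧ (g y ≠ 0 → |y| ≤ C) := by
  have hK : IsCompact (s ∩ tsupport g) := hc.isCompact.inter_left hs
  obtain ⟨M, hM⟩ := hK.exists_bound_of_continuousOn (hg.mono inter_subset_left)
  obtain ⟨R, hR⟩ := hc.isCompact.isBounded.exists_norm_le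
  filter_upwards [eventually_ge_atTop M, eventually_ge_atTop R, eventually_ge_atTop 0]
    with C h1 h2 h3 y hy
  refine ⟨?_, fun h => (hR y (subset_tsupport g h)).trans h2⟩
  by_cases h : g y = 0
  · simpa [h] using h3
  · exact (hM y ⟨hy, subset_tsupport g h⟩).trans h1

theorem exists_overlap_bound (C : ℝ) : ∃ D : ℕ, ∀ y : ℝ, ∃ F : Finset ℤ, F.card ≤ D ∧
    ∀ k : ℤ, |y - k| ≤ C → k ∈ F := by
  refine ⟨(⌈2 * C⌉ + 1).toNat, fun y => ⟨Finset.Icc ⌈y - C⌉ ⌊y + C⌋, ?_, fun k hk => ?_⟩⟩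
  · rw [Int.card_Icc]
    refine Int.toNat_le_toNat ?_
    have h1 := Int.floor_le (y + C)
    have h2 := Int.le_ceil (y - C)
    have h3 := Int.le_ceil (2 * C)
    have : (⌊y + C⌋ : ℝ) ≤ (⌈2 * C⌉ + ⌈y - C⌉ : ℤ) := by
      push_cast
      linarith
    have := Int.cast_le.1 this
    omega
  · rw [abs_le] at hk
    rw [Finset.mem_Icc, Int.ceil_le, Int.le_floor]
    constructor <;> linarith

theorem integral_eq_integral_comp_dyadic (F : ℝ → ℝ) (l : ℕ) (x₀ : ℝ) :
    ∫ x, F x = (1 / 2) ^ l * ∫ y, F (x₀ + (1 / 2) ^ l * y) := by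
  have h := Measure.integral_comp_mul_left (fun z => F (x₀ + z)) ((1 / 2 : ℝ) ^ l)
  rw [integral_add_left_eq_self F] at h
  rw [h, abs_of_pos (by positivity), smul_eq_mul, ← mul_assoc, mul_inv_cancel₀ (by positivity),
    one_mul]

/-- A smooth compactly supported density that can be flattened by dilation. -/
theorem exists_smooth_density (S : ℕ) : ∃ (h : ℝ → ℝ) (c : ℝ), 0 < c ∧ ContDiff ℝ S h ∧
    HasCompactSupport h ∧ (∀ x, 0 ≤ h x) ∧ ∫ x, h x = 1 ∧ ∀ x, |x| ≤ 1 → c ≤ h x := by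
  let b : ContDiffBump (0 : ℝ) := ⟨1, 2, one_pos, one_lt_two⟩
  refine ⟨b.normed volume, 1 / ∫ x, b x, one_div_pos.2 b.integral_pos, ?_,
    b.hasCompactSupport_normed, b.nonneg_normed, b.integral_normed, fun x hx => ?_⟩
  · exact_mod_cast b.contDiff_normed (n := (S : ℕ∞))
  · rw [b.normed_def, b.one_of_mem_closedBall (by simpa [b] using hx)]

/-! ### Bases on the line -/

namespace WaveletSystem

variable {W : WaveletSystem}

theorem localized_line {φ ψ : ℝ → ℝ} (hψ : Continuous ψ) {C : ℝ} (hC : 0 < C)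
    (hψC : ∀ y, |ψ y| ≤ C ∧ (ψ y ≠ 0 → |y| ≤ C)) : ∃ D, (line φ ψ).Localized C D := by
  obtain ⟨D, hD⟩ := exists_overlap_bound C
  refine ⟨D, hC, MeasurableSet.univ, fun l k _ _ => ?_, fun l k _ _ x _ => ?_,
    fun l k _ _ => ⟨k, fun x _ hx => ?_⟩, fun l _ x _ => ?_⟩
  · simp only [line]
    fun_prop
  · simp only [line]
    rw [abs_mul, abs_of_pos (by positivity : (0 : ℝ) < 2 ^ ((l : ℝ) / 2)), mul_comm]
    gcongr
    exact (hψC _).1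
  · exact (hψC _).2 (right_ne_zero_of_mul hx)
  · obtain ⟨F, hF, hFk⟩ := hD (2 ^ l * x)
    exact ⟨F, hF, fun k _ hk => hFk k ((hψC _).2 (right_ne_zero_of_mul hk))⟩

theorem IsONB.line_orthogonal {φ ψ : ℝ → ℝ} (hO : (line φ ψ).IsONB) (j : ℕ) (hj : 0 < j) (k : ℤ) :
    ∫ x, ψ x * ψ (2 ^ j * x - k) = 0 := by
  have h := hO.integral_wavelet_mul_wavelet (l := 0) (l' := j) (k := 0) (k' := k) le_rfl
    (mem_univ _) (Nat.zero_le _) (mem_univ _)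
  rw [if_neg (by omega)] at h
  simp only [line, Measure.restrict_univ, Nat.cast_zero, zero_div, Real.rpow_zero, pow_zero,
    one_mul, Int.cast_zero, sub_zero] at h
  simp_rw [mul_left_comm (ψ _)] at h
  rw [integral_const_mul] at h
  exact (mul_eq_zero.1 h).resolve_left (by positivity)

theorem IsONB.line_wavelet_ne_zero {φ ψ : ℝ → ℝ} (hO : (line φ ψ).IsONB) : ψ ≠ 0 := by
  rintro rfl
  have h := hO.integral_wavelet_mul_wavelet (l := 0) (l' := 0) (k := 0) (k' := 0) le_rfl
    (mem_univ _) le_rfl (mem_univ _)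
  simp [line] at h

theorem IsLineBasis.exists_separated {S : ℕ} (hW : W.IsLineBasis S) {B s t : ℝ} (hB : 0 < B)
    (hs : 0 < s) (hst : s < t) (hsS : s < S) : (∃ C D, W.Localized C D) ∧
    ∃ f ∈ W.Sigma B s, (∃ d : ℝ, 0 < d ∧ ENNReal.ofReal d ≤ W.distTo f (W.Sigma B t)) ∧
      ∀ ε : ℝ, 0 < ε → ∀ ℓ : ℕ, f ∉ W.barSigma B ε s ℓ := by
  obtain ⟨φ, ψ, hφ, hφc, hψ, hψc, rfl, hO⟩ := hW
  obtain ⟨C, hψC, hC⟩ := ((eventually_abs_le_and_support isClosed_univ hψ.continuous.continuousOn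
    hψc).and (eventually_gt_atTop 0)).exists
  replace hψC : ∀ y, |ψ y| ≤ C ∧ (ψ y ≠ 0 → |y| ≤ C) := fun y => hψC y (mem_univ y)
  obtain ⟨D, hD⟩ := localized_line (φ := φ) hψ.continuous hC hψC
  refine ⟨⟨C, D, hD⟩, ?_⟩
  have hS : 0 < S := by exact_mod_cast hs.trans hsS
  have hmom := moment_eq_zero_of_orthogonal hψ (fun y => (hψC y).2) hO.line_wavelet_ne_zero
    hO.line_orthogonal
  obtain ⟨h, c, hc, hh, hhc, hh0, hh1, hhlow⟩ := exists_smooth_density S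
  obtain ⟨M, hM⟩ := hhc.exists_bound_of_continuous hh.continuous
  have hM0 : 0 ≤ M := (norm_nonneg _).trans (hM 0)
  obtain ⟨E, hE⟩ := exists_iteratedDeriv_bound hh hhc
  have hE0 : 0 ≤ E := (abs_nonneg _).trans (hE 0)
  set Iφ := ∫ x, |φ x| with hIφ
  set Iψ := ∫ x, |ψ x| with hIψ
  have hIφ0 : 0 ≤ Iφ := integral_nonneg fun x => abs_nonneg _
  have hIψ0 : 0 ≤ Iψ := integral_nonneg fun x => abs_nonneg _
  -- Each summand of `Q` pays for one requirement on `δ = 1/Q`: `δ ≤ 1`, `δ C ≤ 1` (the support of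
  -- `ψ` lies where the bump is bounded below), scaling coefficients at most `B`, and wavelet
  -- coefficients within `B/2`.
  set Q := 1 + C + M * Iφ / B + 2 * (E * C ^ S * Iψ) / B with hQ
  have hq1 : 0 ≤ M * Iφ / B := by positivity
  have hq2 : 0 ≤ 2 * (E * C ^ S * Iψ) / B := by positivity
  have hQ1 : 1 ≤ Q := by linarith
  have hQ0 : 0 < Q := by linarith
  set δ := 1 / Q with hδ
  have hδ0 : 0 < δ := by positivity
  have hδ1 : δ ≤ 1 := by rw [hδ, div_le_one hQ0]; exact hQ1
  have hδC : δ * C ≤ 1 := by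
    rw [hδ, one_div_mul_eq_div, div_le_one hQ0]
    linarith
  have hδφ : δ * M * Iφ ≤ B := by
    rw [mul_assoc, hδ, one_div_mul_eq_div, div_le_iff₀ hQ0, ← div_le_iff₀' hB]
    linarith
  have hδψ : δ * E * C ^ S * Iψ ≤ B / 2 := by
    have : δ * E * C ^ S * Iψ = (E * C ^ S * Iψ) / Q := by rw [hδ]; ring
    rw [this, div_le_iff₀ hQ0, div_mul_eq_mul_div, le_div_iff₀ two_pos, ← div_le_iff₀' hB]
    have : E * C ^ S * Iψ * 2 / B = 2 * (E * C ^ S * Iψ) / B := by ring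
    linarith
  have hfh : ContDiff ℝ S fun x => h (δ * x) := hh.comp (contDiff_const.mul contDiff_id)
  set f₀ : ℝ → ℝ := fun x => δ * h (δ * x) with hf₀
  have hf₀c : ContDiff ℝ S f₀ := contDiff_const.mul hfh
  have hf₀M : ∀ x, |f₀ x| ≤ δ * M := fun x => by
    rw [hf₀, abs_mul, abs_of_pos hδ0]
    exact mul_le_mul_of_nonneg_left (hM _) hδ0.le
  have hf₀s : HasCompactSupport f₀ :=
    (hhc.comp_homeomorph (Homeomorph.mulLeft₀ δ hδ0.ne')).mul_left
  have hf₀D : ∀ x, |iteratedDeriv S f₀ x| ≤ δ * E := by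
    intro x
    rw [hf₀, iteratedDeriv_const_mul_field, iteratedDeriv_comp_const_mul hh, abs_mul, abs_mul,
      abs_of_pos hδ0, abs_of_pos (pow_pos hδ0 S)]
    refine mul_le_mul_of_nonneg_left ?_ hδ0.le
    calc δ ^ S * |iteratedDeriv S h (δ * x)| ≤ 1 * E :=
          mul_le_mul (pow_le_one₀ hδ0.le hδ1) (hE _) (abs_nonneg _) zero_le_one
      _ = E := one_mul E
  refine hD.exists_separated hO hB hs hst hsS (f₀ := f₀) (c₀ := δ * c) (M := δ * M)
    (by positivity) hf₀c.continuous.continuousOn (fun x _ => hf₀M x)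
    ((hf₀c.continuous.memLp_of_hasCompactSupport hf₀s).restrict _)
    (fun x _ => mul_nonneg hδ0.le (hh0 _)) ?_ (fun k _ => ?_) (fun l k _ _ => ?_)
    (fun l _ => ⟨0, mem_univ _, ?_, fun x _ hx => ?_⟩)
  · change ∫ x in univ, δ * h (δ * x) = 1
    rw [Measure.restrict_univ, integral_const_mul, Measure.integral_comp_mul_left, hh1,
      abs_of_pos (by positivity), smul_eq_mul, mul_one, mul_inv_cancel₀ hδ0.ne']
  · change |∫ x in univ, f₀ x * φ (x - k)| ≤ B
    rw [Measure.restrict_univ]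
    refine (abs_integral_le_integral_abs.trans (integral_mono_of_nonneg
      (g := fun x => δ * M * |φ (x - k)|) (Eventually.of_forall fun x => abs_nonneg _) ?_
      (Eventually.of_forall fun x => ?_))).trans ?_
    · exact (((hφ.continuous.integrable_of_hasCompactSupport hφc).abs).comp_sub_right
        (k : ℝ)).const_mul _
    · simp only [abs_mul]
      exact mul_le_mul_of_nonneg_right (hf₀M x) (abs_nonneg _)
    · rw [integral_const_mul, integral_sub_right_eq_self fun x => |φ x|]
      exact hδφ
  · change |∫ x in univ, f₀ x * (2 ^ ((l : ℝ) / 2) * ψ (2 ^ l * x - k))| ≤ _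
    rw [Measure.restrict_univ, integral_eq_integral_comp_dyadic _ l (k / 2 ^ l)]
    have e : ∀ y : ℝ, f₀ (k / 2 ^ l + (1 / 2) ^ l * y) *
        (2 ^ ((l : ℝ) / 2) * ψ (2 ^ l * (k / 2 ^ l + (1 / 2) ^ l * y) - k)) =
        2 ^ ((l : ℝ) / 2) * (f₀ (k / 2 ^ l + (1 / 2) ^ l * y) * ψ y) := by
      intro y
      have : (2 : ℝ) ^ l * (k / 2 ^ l + (1 / 2) ^ l * y) - k = y := by
        rw [one_div, inv_pow]
        field_simp
        ring
      rw [this]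
      ring
    simp_rw [e]
    rw [integral_const_mul, ← mul_assoc, abs_mul,
      abs_of_pos (by positivity : (0 : ℝ) < (1 / 2) ^ l * 2 ^ ((l : ℝ) / 2))]
    -- After recentring at `k / 2^l`, the vanishing moments remove the whole Taylor sum, leaving a
    -- remainder of order `2^(-lS)`; with the normalization `2^(-l/2)` this is the decay for `u =
    -- S`.
    have h1 := abs_integral_sub_taylorSum_le hf₀c hf₀D hψ.continuous (fun y => (hψC y).2)
      (k / 2 ^ l) ((1 / 2) ^ l)
    rw [Finset.sum_eq_zero fun i hi => by rw [hmom i (Finset.mem_range.1 hi), mul_zero], sub_zero,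
      abs_of_pos (by positivity : (0 : ℝ) < (1 / 2) ^ l), mul_pow] at h1
    have e2 : (1 / 2 : ℝ) ^ l * 2 ^ ((l : ℝ) / 2) * ((1 / 2) ^ l) ^ S =
        2 ^ (-((l : ℝ) * (S + 1 / 2))) := by
      rw [one_div, inv_pow, ← Real.rpow_natCast, ← Real.rpow_neg two_pos.le, ← Real.rpow_natCast,
        ← Real.rpow_mul two_pos.le, ← Real.rpow_add two_pos, ← Real.rpow_add two_pos]
      ring_nf
    calc (1 / 2 : ℝ) ^ l * 2 ^ ((l : ℝ) / 2) * |∫ y, f₀ (k / 2 ^ l + (1 / 2) ^ l * y) * ψ y|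
        ≤ (1 / 2 : ℝ) ^ l * 2 ^ ((l : ℝ) / 2) * (δ * E * (((1 / 2) ^ l) ^ S * C ^ S) * Iψ) := by
          gcongr
      _ = δ * E * C ^ S * Iψ * ((1 / 2 : ℝ) ^ l * 2 ^ ((l : ℝ) / 2) * ((1 / 2) ^ l) ^ S) := by ring
      _ ≤ _ := by
          rw [e2]
          gcongr
  · change ∫ x in univ, 2 ^ ((l : ℝ) / 2) * ψ (2 ^ l * x - (0 : ℤ)) = 0
    have h0 := hmom 0 hS
    simp only [pow_zero, one_mul] at h0
    simp only [Int.cast_zero, sub_zero]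
    rw [Measure.restrict_univ, integral_const_mul, Measure.integral_comp_mul_left, h0, smul_zero,
      mul_zero]
  -- The wavelet with `k = 0` lives on `|x| ≤ C` at every level, where `δ |x| ≤ 1` and the flattened
  -- bump is at least `δ c`.
  · have h2 := (hψC _).2 (right_ne_zero_of_mul hx)
    rw [Int.cast_zero, sub_zero, abs_mul, abs_of_pos (by positivity)] at h2
    refine mul_le_mul_of_nonneg_left (hhlow _ ?_) hδ0.le
    rw [abs_mul, abs_of_pos hδ0]
    refine (mul_le_mul_of_nonneg_left ?_ hδ0.le).trans hδC
    exact (le_mul_of_one_le_left (abs_nonneg x) (one_le_pow₀ one_le_two)).trans h2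

/-! ### Bases on the interval -/

theorem IsIntervalBasis.exists_localized {S : ℕ} (hW : W.IsIntervalBasis S) :
    ∃ C D, W.Localized C D := by
  obtain ⟨J₀, N, M, φ, ψ, ψL, ψR, -, -, hψ, hψs, hL, hR, rfl, -, -⟩ := hW
  have hψc : HasCompactSupport ψ := HasCompactSupport.of_support_subset_isCompact isCompact_Icc
    ((subset_tsupport ψ).trans hψs)
  obtain ⟨C, hC, hψC, hLC, hRC⟩ := ((eventually_gt_atTop 0).and
    ((eventually_abs_le_and_support isClosed_univ hψ.continuous.continuousOn hψc).and
    (((eventually_all_finite (finite_Ico (0 : ℤ) N)).2 fun j hj =>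
      eventually_abs_le_and_support isClosed_Ici (hL j hj).1.continuousOn (hL j hj).2).and
    ((eventually_all_finite (finite_Ico (0 : ℤ) N)).2 fun j hj =>
      eventually_abs_le_and_support isClosed_Ici (hR j hj).1.continuousOn (hR j hj).2)))).exists
  obtain ⟨D, hD⟩ := exists_overlap_bound C
  have hleft : ∀ l : ℕ, ∀ x ∈ Icc (0 : ℝ) 1, (2 : ℝ) ^ l * x ∈ Ici (0 : ℝ) :=
    fun l x hx => mul_nonneg (by positivity) hx.1
  have hright : ∀ l : ℕ, ∀ x ∈ Icc (0 : ℝ) 1, (2 : ℝ) ^ l * (1 - x) ∈ Ici (0 : ℝ) :=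
    fun l x hx => mul_nonneg (by positivity) (sub_nonneg.2 hx.2)
  refine ⟨C, D + N + N, hC, measurableSet_Icc, fun l k _ hk => ?_, fun l k _ hk x hx => ?_,
    fun l k _ hk => ?_, fun l _ x hx => ?_⟩
  · refine ContinuousOn.mul continuousOn_const ?_
    change k ∈ Ico (0 : ℤ) (2 ^ l) at hk
    rw [mem_Ico] at hk
    by_cases h1 : k < N
    · simp only [h1, if_true]
      exact (hL k ⟨hk.1, h1⟩).1.continuousOn.comp (by fun_prop) (hleft l)
    by_cases h2 : k < 2 ^ l - N
    · simp only [h1, h2, if_true, if_false]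
      exact hψ.continuous.comp_continuousOn (by fun_prop)
    · simp only [h1, h2, if_false]
      exact (hR _ ⟨by omega, by omega⟩).1.continuousOn.comp (by fun_prop) (hright l)
  · change k ∈ Ico (0 : ℤ) (2 ^ l) at hk
    rw [mem_Ico] at hk
    simp only [interval]
    rw [abs_mul, abs_of_pos (by positivity : (0 : ℝ) < 2 ^ ((l : ℝ) / 2)), mul_comm]
    gcongr
    split_ifs with h1 h2
    · exact (hLC k ⟨hk.1, h1⟩ _ (hleft l x hx)).1
    · exact (hψC _ (mem_univ _)).1
    · exact (hRC _ ⟨by omega, by omega⟩ _ (hright l x hx)).1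
  · change k ∈ Ico (0 : ℤ) (2 ^ l) at hk
    rw [mem_Ico] at hk
    simp only [interval]
    by_cases h1 : k < N
    · refine ⟨0, fun x hx hne => ?_⟩
      simp only [h1, if_true] at hne
      rw [sub_zero]
      exact (hLC k ⟨hk.1, h1⟩ _ (hleft l x hx)).2 (right_ne_zero_of_mul hne)
    by_cases h2 : k < 2 ^ l - N
    · refine ⟨k, fun x hx hne => ?_⟩
      simp only [h1, h2, if_true, if_false] at hne
      exact (hψC _ (mem_univ _)).2 (right_ne_zero_of_mul hne)
    · refine ⟨2 ^ l, fun x hx hne => ?_⟩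
      simp only [h1, h2, if_false] at hne
      have h3 := (hRC _ ⟨by omega, by omega⟩ _ (hright l x hx)).2 (right_ne_zero_of_mul hne)
      rwa [mul_sub, mul_one, abs_sub_comm] at h3
  · obtain ⟨F, hF, hFk⟩ := hD (2 ^ l * x)
    -- Only interior wavelets need the translation count; the `N` boundary indices on each side are
    -- all admitted.
    refine ⟨F ∪ Finset.Ico 0 (N : ℤ) ∪ Finset.Ico (2 ^ l - N) (2 ^ l), ?_, fun k hk hne => ?_⟩
    · refine (Finset.card_union_le _ _).trans (add_le_add ((Finset.card_union_le _ _).trans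
        (add_le_add hF ?_)) ?_) <;> simp
    · change k ∈ Ico (0 : ℤ) (2 ^ l) at hk
      rw [mem_Ico] at hk
      simp only [Finset.mem_union, Finset.mem_Ico]
      by_cases h1 : k < N
      · exact Or.inl (Or.inr ⟨hk.1, h1⟩)
      by_cases h2 : k < 2 ^ l - N
      · simp only [interval, h1, h2, if_true, if_false] at hne
        exact Or.inl (Or.inl (hFk k ((hψC _ (mem_univ _)).2 (right_ne_zero_of_mul hne))))
      · exact Or.inr ⟨by omega, hk.2⟩

/-- The uniform density is the base function: the zeroth vanishing moment kills all its wavelet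
coefficients, and it is bounded below on all of `[0,1]`. -/
theorem IsIntervalBasis.exists_separated {S : ℕ} (hW : W.IsIntervalBasis S) {B s t : ℝ}
    (hB : 1 ≤ B) (hs : 0 < s) (hst : s < t) (hsS : s < S) :
    ∃ f ∈ W.Sigma B s, (∃ d : ℝ, 0 < d ∧ ENNReal.ofReal d ≤ W.distTo f (W.Sigma B t)) ∧
      ∀ ε : ℝ, 0 < ε → ∀ ℓ : ℕ, f ∉ W.barSigma B ε s ℓ := by
  have hB0 : 0 < B := by linarith
  obtain ⟨C, D, hD⟩ := hW.exists_localized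
  obtain ⟨J₀, N, M, φ, ψ, ψL, ψR, -, -, -, -, -, -, hWeq, hO, hmom⟩ := hW
  have hT : W.T = Icc 0 1 := by rw [hWeq]; rfl
  have hS : 0 < S := by exact_mod_cast hs.trans hsS
  have hmom0 : ∀ l k, W.J₀ ≤ l → k ∈ W.waveIdx l → ∫ x in W.T, W.ψ l k x = 0 := by
    intro l k hl hk
    simpa using hmom 0 hS l hl k hk
  have : IsFiniteMeasure (volume.restrict W.T) := by
    rw [hT]
    infer_instance
  have hvol : ∫ _ in W.T, (1 : ℝ) = 1 := by simp [hT]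
  refine hD.exists_separated hO hB0 hs hst hsS (f₀ := fun _ => 1) (c₀ := 1) (M := 1) one_pos
    continuousOn_const (by simp) (memLp_const 1) (fun _ _ => zero_le_one) hvol (fun k hk => ?_)
    (fun l k hl hk => ?_) (fun l _ => ⟨0, ?_, hmom0 l 0 ‹_› ?_, fun _ _ _ => le_rfl⟩)
  · have hφ := hO.memLp_scaling hk
    have hφ1 : Integrable (W.φ k) (volume.restrict W.T) := hφ.integrable one_le_two
    have hφ2 : Integrable (fun x => W.φ k x * W.φ k x) (volume.restrict W.T) := hφ.integrable_mul hφ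
    -- From |φ| ≤ (1 + φ²)/2 and ∫ φ² = 1, the scaling coefficients of the uniform density are at
    -- most 1, and `1 ≤ B`.
    have h1 : ∫ x in W.T, (1 / 2 + 1 / 2 * (W.φ k x * W.φ k x)) = 1 := by
      rw [integral_add (integrable_const _) (hφ2.const_mul _), integral_const_mul,
        hO.integral_scaling_mul_self hk]
      simp [hT]
      norm_num
    unfold alpha
    simp only [one_mul]
    refine abs_integral_le_integral_abs.trans ((integral_mono_of_nonneg
      (g := fun x => 1 / 2 + 1 / 2 * (W.φ k x * W.φ k x))
      (Eventually.of_forall fun x => abs_nonneg _) ((integrable_const _).add (hφ2.const_mul _))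
      (Eventually.of_forall fun x => ?_)).trans (h1.le.trans hB))
    simp only
    nlinarith [sq_nonneg (|W.φ k x| - 1), abs_mul_abs_self (W.φ k x)]
  · unfold beta
    simp only [one_mul]
    rw [hmom0 l k hl hk, abs_zero]
    positivity
  · rw [hWeq]
    exact ⟨le_rfl, by positivity⟩
  · rw [hWeq]
    exact ⟨le_rfl, by positivity⟩

theorem IsRegularBasis.exists_localized_and_separated {S : ℕ} (hW : W.IsRegularBasis S)
    {B s t : ℝ} (hB : 1 ≤ B) (hs : 0 < s) (hst : s < t) (hsS : s < S) :
    (∃ C D, W.Localized C D) ∧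
    ∃ f ∈ W.Sigma B s, (∃ d : ℝ, 0 < d ∧ ENNReal.ofReal d ≤ W.distTo f (W.Sigma B t)) ∧
      ∀ ε : ℝ, 0 < ε → ∀ ℓ : ℕ, f ∉ W.barSigma B ε s ℓ := by
  rcases hW with hW | hW
  · exact hW.exists_separated (by linarith) hs hst hsS
  · exact ⟨hW.exists_localized, hW.exists_separated hB hs hst hsS⟩

end WaveletSystem

/-! ### The rate and the growth condition -/

theorem minimaxRate_nonneg (n : ℕ) (s : ℝ) : 0 ≤ minimaxRate n s :=
  Real.rpow_nonneg (div_nonneg (Real.log_natCast_nonneg n) n.cast_nonneg) _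

theorem tendsto_log_div_natCast : Tendsto (fun n : ℕ => Real.log n / n) atTop (nhds 0) :=
  (Real.isLittleO_log_id_atTop.tendsto_div_nhds_zero).comp tendsto_natCast_atTop_atTop

theorem tendsto_minimaxRate {s : ℝ} (hs : 0 < s) :
    Tendsto (fun n => minimaxRate n s) atTop (nhds 0) := by
  have hp : 0 < s / (2 * s + 1) := by positivity
  have := tendsto_log_div_natCast.rpow_const (p := s / (2 * s + 1)) (Or.inr hp.le)
  rwa [Real.zero_rpow hp.ne'] at this

/-- With X = n / log n, the rate is X^(-s/(2s+1)), while the upper half of the order relation gives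
2^(-ℓₙs) ≥ c^(-s) X^(-s/(2R+1)). The quotient grows at least like X to the positive power s/(2s+1) -
s/(2R+1). -/
theorem growthCondition_of_isTheta {s R : ℝ} (hs : 0 < s) (hR : s < R) {ℓ : ℕ → ℕ}
    (h : (fun n : ℕ => (2 : ℝ) ^ (ℓ n)) =Θ[atTop]
      (fun n : ℕ => ((n : ℝ) / Real.log n) ^ (1 / (2 * R + 1)))) : GrowthCondition ℓ s := by
  have hR0 : 0 < R := hs.trans hR
  obtain ⟨c, hc, hb⟩ := h.1.exists_pos
  have hx : Tendsto (fun n : ℕ => (n : ℝ) / Real.log n) atTop atTop := by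
    have h1 : Tendsto (fun n : ℕ => Real.log n / n) atTop (nhdsWithin 0 (Ioi 0)) := by
      refine tendsto_nhdsWithin_iff.2 ⟨tendsto_log_div_natCast, ?_⟩
      filter_upwards [eventually_gt_atTop 1] with n hn
      have hn' : (1 : ℝ) < n := by exact_mod_cast hn
      exact div_pos (Real.log_pos hn') (by linarith)
    simpa only [Function.comp_def, Pi.inv_def, inv_div] using h1.inv_tendsto_nhdsGT_zero
  set p := s / (2 * s + 1) - s / (2 * R + 1) with hp
  have hp0 : 0 < p := by
    rw [hp, sub_pos]
    gcongr
  have hlim : Tendsto (fun n : ℕ => c ^ (-s) * ((n : ℝ) / Real.log n) ^ p) atTop atTop :=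
    ((tendsto_rpow_atTop hp0).comp hx).const_mul_atTop (by positivity)
  refine tendsto_atTop_mono' atTop ?_ hlim
  filter_upwards [hb.bound, hx.eventually_gt_atTop 0] with n h1 h2
  set X := (n : ℝ) / Real.log n with hX
  rw [Real.norm_of_nonneg (by positivity), Real.norm_of_nonneg (by positivity)] at h1
  have hrate : minimaxRate n s = X ^ (-(s / (2 * s + 1))) := by
    rw [minimaxRate, ← inv_div, ← hX, Real.inv_rpow h2.le, Real.rpow_neg h2.le]
  have h3 : (2 : ℝ) ^ (-((ℓ n : ℝ) * s)) = ((2 : ℝ) ^ ℓ n) ^ (-s) := by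
    rw [← Real.rpow_natCast, ← Real.rpow_mul two_pos.le, mul_neg]
  have h4 : (c * X ^ (1 / (2 * R + 1))) ^ (-s) ≤ ((2 : ℝ) ^ ℓ n) ^ (-s) :=
    Real.rpow_le_rpow_of_nonpos (by positivity) h1 (by linarith)
  rw [hrate, h3, le_div_iff₀ (by positivity), mul_assoc, ← Real.rpow_add h2]
  refine le_trans (le_of_eq ?_) h4
  rw [Real.mul_rpow hc.le (by positivity), ← Real.rpow_mul h2.le]
  congr 2
  rw [hp]
  ring

/-! ### Assembly of the theorem -/

theorem proposition3 (S : ℕ) (W : WaveletSystem) (hW : W.IsRegularBasis S)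
    (B s t : ℝ) (hB : 1 ≤ B) (hs : 0 < s) (hsS : s < S) (hst : s < t) :
    -- (a), first claim
    (∀ ε : ℝ, 0 < ε → ∃ c : ℝ, 0 < c ∧ ∀ ℓ : ℕ, ∀ f ∈ W.barSigma B ε s ℓ,
      ENNReal.ofReal (c * (2 : ℝ) ^ (-((ℓ : ℝ) * s))) ≤ W.distTo f (W.Sigma B t)) ∧
    -- (a), second claim
    (∀ ε : ℝ, 0 < ε → ∀ L₀ : ℝ, 0 < L₀ → ∀ ℓ : ℕ → ℕ, GrowthCondition ℓ s →
      ∃ n₀ : ℕ, ∀ n ≥ n₀,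
        W.barSigma B ε s (ℓ n) ⊆ W.tildeSigma B s t (L₀ * minimaxRate n s)) ∧
    -- (b), with a threshold that does not depend on `ε` and `ℓ`
    (∀ L₀' : ℝ, 0 < L₀' → ∃ n₀ : ℕ, ∀ ε : ℝ, 0 < ε → ∀ ℓ : ℕ → ℕ, GrowthCondition ℓ s →
      ∀ n ≥ n₀,
        (W.tildeSigma B s t (L₀' * minimaxRate n s) \ W.barSigma B ε s (ℓ n)).Nonempty) ∧
    -- the growth condition holds in the adaptive case
    (∀ R : ℝ, s < R → ∀ ℓ : ℕ → ℕ,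
      (fun n : ℕ => (2 : ℝ) ^ (ℓ n)) =Θ[atTop]
        (fun n : ℕ => ((n : ℝ) / Real.log n) ^ (1 / (2 * R + 1))) →
      GrowthCondition ℓ s) := by
  have hB0 : 0 < B := by linarith
  obtain ⟨⟨C, D, hD⟩, f, hf, ⟨d, hd, hfd⟩, hfb⟩ :=
    hW.exists_localized_and_separated hB hs hst hsS
  have ha := fun ε (hε : 0 < ε) => hD.exists_le_distTo (t := t) hB0 hε hs hst
  refine ⟨ha, fun ε hε L₀ hL₀ ℓ hℓ => ?_, fun L₀ hL₀ => ?_,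
    fun R hR ℓ hℓ => growthCondition_of_isTheta hs hR hℓ⟩
  · obtain ⟨c, hc, hc'⟩ := ha ε hε
    obtain ⟨n₀, hn₀⟩ := eventually_atTop.1 (hℓ.eventually_ge_atTop (L₀ / c))
    refine ⟨n₀, fun n hn g hg => ⟨hg.1, (ENNReal.ofReal_le_ofReal ?_).trans (hc' (ℓ n) g hg)⟩⟩
    have h1 := hn₀ n hn
    -- A zero rate makes the quotient in the growth condition a default value, but the required
    -- inequality is then trivial.
    rcases (minimaxRate_nonneg n s).eq_or_lt with h0 | h0
    · rw [← h0, mul_zero]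
      positivity
    · rw [div_le_div_iff₀ hc h0] at h1
      linarith
  · have h1 := (tendsto_minimaxRate hs).const_mul L₀
    rw [mul_zero] at h1
    obtain ⟨n₀, hn₀⟩ := eventually_atTop.1 (h1.eventually_le_const hd)
    -- The witness `f` and its distance `d` were fixed before `ε` and `ℓ`, so `n₀` only has to bring
    -- the rate below `d / L₀`.
    exact ⟨n₀, fun ε hε ℓ _ n hn =>
      ⟨f, ⟨hf, (ENNReal.ofReal_le_ofReal (hn₀ n hn)).trans hfd⟩, hfb ε hε (ℓ n)⟩⟩
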